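/- Let $K$ be a field, let $1 \le t \le n$ be integers, and let $S = K[x_1,\ldots,x_n]$. Let $L_n$ be the line graph (path graph) with vertex set $\{x_1,\ldots,x_n\}$ and edge set $\{\{x_j,x_{j+1}\} : 1 \le j \le n-1\}$. Let $I_t(L_n) \subseteq S$ be its $t$-path ideal, that is, the ideal generated by all monomials $x_{i_1}x_{i_2}\cdots x_{i_t}$ such that $x_{i_1},\ldots,x_{i_t}$ are pairwise distinct and $\{x_{i_k},x_{i_{k+1}}\}$ is an edge of $L_n$ for $1 \le k \le t-1$ (for $t=1$ this is the ideal $(x_1,\ldots,x_n)$). Then $I_t(L_n)$ is normal, that is, $$\overline{I_t(L_n)^s} = I_t(L_n)^s \qquad \text{for all } s \ge 1,$$ where, for an ideal $J$ of $S$, the integral closure $\overline{J}$ is the set of all $r \in S$ satisfying an equation $r^m + a_1 r^{m-1} + \cdots + a_m = 0$ with $m \ge 1$ and $a_i \in J^i$ for $i = 1,\ldots,m$. -/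

import Mathlib

/-- The `t`-path ideal of a simple graph `G` in the polynomial ring `K[x_v : v ∈ V]`: the ideal
generated by the monomials `x_{i_1} ⋯ x_{i_t}`, where `i_1, …, i_t` are the successive, pairwise
distinct vertices of a path of `G` with exactly `t` vertices (for `t = 1`, a single vertex). -/
noncomputable def pathIdeal (K : Type*) [CommRing K] {V : Type*} (G : SimpleGraph V) (t : ℕ) :
    Ideal (MvPolynomial V K) :=
  Ideal.span {m | ∃ (u v : V) (p : G.Walk u v), p.IsPath ∧ p.support.length = t ∧
    m = (p.support.map (fun w => (MvPolynomial.X w : MvPolynomial V K))).prod}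

/-- The integral closure of an ideal `I` in the ring `R`: the set of all `r` that satisfy an
equation `r ^ m + a 1 * r ^ (m - 1) + ⋯ + a m = 0` with `m ≥ 1` and `a i ∈ I ^ i` for
`i = 1, …, m`. -/
def idealIntegralClosure {R : Type*} [CommRing R] (I : Ideal R) : Set R :=
  {r | ∃ m : ℕ, 1 ≤ m ∧ ∃ a : ℕ → R, (∀ i ∈ Finset.Icc 1 m, a i ∈ I ^ i) ∧
    r ^ m + ∑ i ∈ Finset.Icc 1 m, a i * r ^ (m - i) = 0}

/-- An ideal is normal if all of its positive powers are integrally closed. -/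
def IsNormalIdeal {R : Type*} [CommRing R] (I : Ideal R) : Prop :=
  ∀ s : ℕ, 1 ≤ s → idealIntegralClosure (I ^ s) = ((I ^ s : Ideal R) : Set R)

open SimpleGraph

/-! Windows of `t` consecutive vertices give the generators of the ideal `I`. The key is a weighted
min-max principle for intervals: if every cover `C` of the windows has `a`-weight at least `s`, then
`s` windows can be packed into `a`, so `x^a ∈ I ^ s` (`prod_X_pow_mem_pow`). Conversely, the order
in the variables of `C` is a valuation that is at least `s` on `I ^ s`, and such a bound passes to
the integral closure (`pow_dvd_of_mem_idealIntegralClosure`). Hence each monomial of an integral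
element satisfies the weight condition. -/

theorem pow_dvd_map_of_mem_pow {R A : Type*} [CommRing R] [CommRing A] (f : R →+* A) {b : A}
    {J : Ideal R} (hJ : ∀ x ∈ J, b ∣ f x) (i : ℕ) {x : R} (hx : x ∈ J ^ i) : b ^ i ∣ f x := by
  have hle : J ≤ (Ideal.span {b}).comap f := fun y hy => Ideal.mem_span_singleton.2 (hJ y hy)
  have h := Ideal.le_comap_pow f i (Ideal.pow_right_mono hle i hx)
  rwa [Ideal.mem_comap, Ideal.span_singleton_pow, Ideal.mem_span_singleton] at h

/-- If `f` maps `J` into the multiples of `π ^ s`, where `π` is prime, then it does so for the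
integral closure of `J`. -/
theorem pow_dvd_of_mem_idealIntegralClosure {R A : Type*} [CommRing R] [CommRing A] [IsDomain A]
    (f : R →+* A) {π : A} (hπ : Prime π) {J : Ideal R} {s : ℕ}
    (hJ : ∀ x ∈ J, π ^ s ∣ f x) {r : R} (hr : r ∈ idealIntegralClosure J) : π ^ s ∣ f r := by
  obtain ⟨m, -, a, ha, heq⟩ := hr
  by_contra hs
  have hpow : ∀ i, ∀ x ∈ J ^ i, π ^ (s * i) ∣ f x := by
    intro i x hx
    rw [pow_mul]
    exact pow_dvd_map_of_mem_pow f hJ i hx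
  classical
  obtain ⟨k, hk, hdvd, hndvd⟩ : ∃ k, k < s ∧ π ^ k ∣ f r ∧ ¬ π ^ (k + 1) ∣ f r := by
    have hex : ∃ k, ¬ π ^ k ∣ f r := ⟨s, hs⟩
    have hpos : Nat.find hex ≠ 0 := fun h0 => by
      have := Nat.find_spec hex
      rw [h0] at this
      simp at this
    obtain ⟨k, hk⟩ := Nat.exists_eq_succ_of_ne_zero hpos
    refine ⟨k, ?_, ?_, ?_⟩
    · have := Nat.find_min' hex hs
      omega
    · exact not_not.1 (Nat.find_min hex (by omega : k < Nat.find hex))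
    · have := Nat.find_spec hex
      rwa [hk] at this
  obtain ⟨u, hu⟩ := hdvd
  have hu' : ¬ π ∣ u := fun ⟨v, hv⟩ => hndvd ⟨v, by rw [hu, hv]; ring⟩
  -- Here `k < s` is the exact order of `f r`. The term with index `i ≥ 1` has order at least `s * i
  -- + k * (m - i) > k * m`, so it cannot cancel `f r ^ m`.
  have hsum : π ^ (k * m + 1) ∣ ∑ i ∈ Finset.Icc 1 m, f (a i) * f r ^ (m - i) := by
    refine Finset.dvd_sum fun i hi => ?_
    have hi' := Finset.mem_Icc.1 hi
    have h1 : π ^ (k * (m - i)) ∣ f r ^ (m - i) := by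
      rw [pow_mul]
      exact pow_dvd_pow_of_dvd ⟨u, hu⟩ _
    refine (pow_dvd_pow π ?_).trans
      ((pow_add π (s * i) (k * (m - i))).dvd.trans (mul_dvd_mul (hpow i _ (ha i hi)) h1))
    obtain ⟨l, rfl⟩ := Nat.exists_eq_add_of_le hi'.2
    rw [Nat.add_sub_cancel_left]
    nlinarith [Nat.mul_le_mul_right i (Nat.succ_le_of_lt hk)]
  have hfr : f r ^ m + ∑ i ∈ Finset.Icc 1 m, f (a i) * f r ^ (m - i) = 0 := by
    simpa using congrArg f heq
  have h2 : π ^ (k * m + 1) ∣ f r ^ m := by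
    rw [eq_neg_of_add_eq_zero_left hfr]
    exact (dvd_neg).2 hsum
  rw [hu, mul_pow, ← pow_mul, pow_succ] at h2
  exact hu' (hπ.dvd_of_dvd_pow ((mul_dvd_mul_iff_left (pow_ne_zero _ hπ.ne_zero)).1 h2))

theorem subset_idealIntegralClosure {R : Type*} [CommRing R] (I : Ideal R) :
    (I : Set R) ⊆ idealIntegralClosure I := fun r hr =>
  ⟨1, le_rfl, fun _ => -r, by simpa using hr, by simp⟩

/-- The grading homomorphism that multiplies the variables in `C` by a new variable. -/
noncomputable def scaleVars (K : Type*) [CommRing K] {σ : Type*} [DecidableEq σ] (C : Finset σ) :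
    MvPolynomial σ K →+* Polynomial (MvPolynomial σ K) :=
  MvPolynomial.eval₂Hom (Polynomial.C.comp MvPolynomial.C)
    (fun i => Polynomial.C (MvPolynomial.X i) * Polynomial.X ^ (if i ∈ C then 1 else 0))

theorem scaleVars_monomial (K : Type*) [CommRing K] {σ : Type*} [DecidableEq σ] [Fintype σ]
    (C : Finset σ) (d : σ →₀ ℕ) (c : K) :
    scaleVars K C (MvPolynomial.monomial d c) =
      Polynomial.monomial (∑ i ∈ C, d i) (MvPolynomial.monomial d c) := by
  rw [scaleVars, MvPolynomial.eval₂Hom_monomial, Finsupp.prod_fintype _ _ (by simp)]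
  have hexp : ∑ i ∈ C, d i = ∑ i, (if i ∈ C then 1 else 0) * d i := by simp
  rw [hexp, ← Polynomial.C_mul_X_pow_eq_monomial, MvPolynomial.monomial_eq,
    Finsupp.prod_fintype _ _ (by simp), ← Finset.prod_pow_eq_pow_sum]
  simp only [mul_pow, Finset.prod_mul_distrib, map_mul, map_prod, map_pow, pow_mul,
    RingHom.comp_apply]
  ring

/-- Distinct monomials never cancel under `scaleVars`, so divisibility by a power of the new
variable can be tested monomial by monomial. -/
theorem coeff_coeff_scaleVars {K : Type*} [CommRing K] {σ : Type*} [DecidableEq σ] [Fintype σ]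
    (C : Finset σ) (d : σ →₀ ℕ) (f : MvPolynomial σ K) :
    ((scaleVars K C f).coeff (∑ i ∈ C, d i)).coeff d = f.coeff d := by
  induction f using MvPolynomial.induction_on' with
  | monomial e c =>
    rw [scaleVars_monomial, Polynomial.coeff_monomial]
    by_cases h : e = d
    · simp [h]
    · split_ifs <;> simp [MvPolynomial.coeff_monomial, h]
  | add p q hp hq => simp [hp, hq]

theorem scaleVars_X_of_mem {K : Type*} [CommRing K] {σ : Type*} [DecidableEq σ] {C : Finset σ}
    {i : σ} (hi : i ∈ C) :
    scaleVars K C (MvPolynomial.X i) = Polynomial.C (MvPolynomial.X i) * Polynomial.X := by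
  simp [scaleVars, hi]

/-- The vertices `j, …, j + t - 1` of the path graph. -/
def window (n t j : ℕ) : Finset (Fin n) :=
  Finset.univ.filter fun i => j ≤ (i : ℕ) ∧ (i : ℕ) < j + t

theorem mem_window {n t j : ℕ} {i : Fin n} :
    i ∈ window n t j ↔ j ≤ (i : ℕ) ∧ (i : ℕ) < j + t := by
  simp [window]

/-- A set of vertices that meets every window. -/
def IsWindowCover (n t : ℕ) (C : Finset (Fin n)) : Prop :=
  ∀ j, j + t ≤ n → ∃ c ∈ C, c ∈ window n t j

/-- The step of the greedy packing of windows: removing the leftmost window contained in the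
support of `a` lowers the weight of every cover to no less than `s`. -/
theorem exists_window_forall_cover {n t s : ℕ} {a : Fin n → ℕ}
    (h : ∀ C, IsWindowCover n t C → s + 1 ≤ ∑ i ∈ C, a i) :
    ∃ j, j + t ≤ n ∧ (∀ i ∈ window n t j, 0 < a i) ∧ ∀ C, IsWindowCover n t C →
      s ≤ ∑ i ∈ C, (a i - if i ∈ window n t j then 1 else 0) := by
  classical
  have hex : ∃ j, j + t ≤ n ∧ ∀ i ∈ window n t j, 0 < a i := by
    by_contra hne
    push Not at hne
    -- Otherwise the zeros of `a` would form a cover of weight 0.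
    have := h (Finset.univ.filter fun i => a i = 0) fun j hj => by
      obtain ⟨i, hi, hi0⟩ := hne j hj
      exact ⟨i, by simpa using hi0, hi⟩
    rw [Finset.sum_eq_zero (by simp)] at this
    omega
  obtain ⟨hj, hpos⟩ := Nat.find_spec hex
  have hmin := fun i hi => Nat.find_min hex (m := i) hi
  set j := Nat.find hex
  refine ⟨j, hj, hpos, fun D hD => ?_⟩
  obtain ⟨q, hq, hqmax⟩ : ∃ q ∈ D ∩ window n t j, ∀ i ∈ D ∩ window n t j, i ≤ q := by
    obtain ⟨c, hc, hcw⟩ := hD j hj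
    have hne : (D ∩ window n t j).Nonempty := ⟨c, Finset.mem_inter.2 ⟨hc, hcw⟩⟩
    exact ⟨_, Finset.max'_mem _ hne, fun i hi => Finset.le_max' _ i hi⟩
  obtain ⟨hqD, hqw⟩ := Finset.mem_inter.1 hq
  have hqw' := mem_window.1 hqw
  set Z : Finset (Fin n) := Finset.univ.filter fun i => (i : ℕ) < j ∧ a i = 0
  -- In the new cover, `Z` meets the windows starting before `j` by minimality of `j`, `q` those
  -- starting in `[j, q]`, and `E` the later ones. It pays only for `q` and `E`, so the removal
  -- costs it just 1.
  set E : Finset (Fin n) := D.filter fun i => j + t ≤ (i : ℕ)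
  have hcover : IsWindowCover n t (Z ∪ insert q E) := by
    intro i hi
    rcases lt_or_ge i j with hij | hij
    · have := hmin i hij
      push Not at this
      obtain ⟨z, hz, hz0⟩ := this hi
      have hz' := mem_window.1 hz
      refine ⟨z, Finset.mem_union_left _ ?_, hz⟩
      refine Finset.mem_filter.2 ⟨Finset.mem_univ _, ?_, by omega⟩
      by_contra hzj
      have := hpos z (mem_window.2 (by omega))
      omega
    · rcases le_or_gt i q with hiq | hiq
      · exact ⟨q, by simp, mem_window.2 (by omega)⟩
      · obtain ⟨c, hc, hcw⟩ := hD i hi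
        have hcw' := mem_window.1 hcw
        refine ⟨c, Finset.mem_union_right _ (Finset.mem_insert_of_mem
          (Finset.mem_filter.2 ⟨hc, ?_⟩)), hcw⟩
        by_contra hlt
        have : c ≤ q := hqmax c (Finset.mem_inter.2 ⟨hc, mem_window.2 (by omega)⟩)
        have : (c : ℕ) ≤ q := this
        omega
  have hqE : q ∉ E := fun hmem => by
    have := (Finset.mem_filter.1 hmem).2
    omega
  have hle : ∑ i ∈ Z ∪ insert q E, a i ≤ a q + ∑ i ∈ E, a i := by
    have h0 : ∑ i ∈ Z, a i = 0 := Finset.sum_eq_zero fun i hi => (Finset.mem_filter.1 hi).2.2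
    have := Finset.sum_union_inter (s₁ := Z) (s₂ := insert q E) (f := a)
    rw [Finset.sum_insert hqE] at this
    omega
  have hge : (a q - 1) + ∑ i ∈ E, a i ≤
      ∑ i ∈ D, (a i - if i ∈ window n t j then 1 else 0) := by
    calc (a q - 1) + ∑ i ∈ E, a i
        = ∑ i ∈ insert q E, (a i - if i ∈ window n t j then 1 else 0) := by
          rw [Finset.sum_insert hqE, if_pos hqw]
          congr 1
          refine Finset.sum_congr rfl fun i hi => ?_
          have hi' := (Finset.mem_filter.1 hi).2
          rw [if_neg fun hw => by have := (mem_window.1 hw).2; omega, Nat.sub_zero]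
      _ ≤ _ := Finset.sum_le_sum_of_subset
          (Finset.insert_subset hqD (Finset.filter_subset _ _))
  have := h _ hcover
  have := hpos q hqw
  omega

theorem prod_X_pow_mem_pow {K : Type*} [CommRing K] {n t : ℕ} {I : Ideal (MvPolynomial (Fin n) K)}
    (hI : ∀ j, j + t ≤ n → ∏ i ∈ window n t j, MvPolynomial.X i ∈ I) (s : ℕ) :
    ∀ a : Fin n → ℕ, (∀ C, IsWindowCover n t C → s ≤ ∑ i ∈ C, a i) →
      ∏ i, (MvPolynomial.X i : MvPolynomial (Fin n) K) ^ a i ∈ I ^ s := by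
  induction s with
  | zero => simp
  | succ s ih =>
    intro a ha
    obtain ⟨j, hj, hpos, hcov⟩ := exists_window_forall_cover ha
    have hsplit : ∏ i, (MvPolynomial.X i : MvPolynomial (Fin n) K) ^ a i =
        (∏ i, MvPolynomial.X i ^ (a i - if i ∈ window n t j then 1 else 0)) *
          ∏ i ∈ window n t j, MvPolynomial.X i := by
      have hw : ∏ i ∈ window n t j, (MvPolynomial.X i : MvPolynomial (Fin n) K) =
          ∏ i, MvPolynomial.X i ^ (if i ∈ window n t j then 1 else 0) := by
        simp [pow_ite, Finset.prod_ite_mem]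
      rw [hw, ← Finset.prod_mul_distrib]
      refine Finset.prod_congr rfl fun i _ => ?_
      rw [← pow_add]
      congr 1
      split_ifs with hi
      · have := hpos i hi
        omega
      · rfl
    rw [hsplit, pow_succ]
    exact Ideal.mul_mem_mul (ih _ hcov) (hI j hj)

theorem exists_walk_support_eq_range' {n : ℕ} (k : ℕ) : ∀ j (hj : j + k < n),
    ∃ (v : Fin n) (p : (pathGraph n).Walk ⟨j, by omega⟩ v),
      p.support.map Fin.val = List.range' j (k + 1) := by
  induction k with
  | zero => exact fun j hj => ⟨_, Walk.nil, by simp⟩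
  | succ k ih =>
    intro j hj
    obtain ⟨v, p, hp⟩ := ih (j + 1) (by omega)
    refine ⟨v, Walk.cons (pathGraph_adj.2 (Or.inl rfl)) p, ?_⟩
    rw [Walk.support_cons, List.map_cons, hp, List.range'_succ (n := k + 1)]

theorem prod_window_mem_pathIdeal (K : Type*) [CommRing K] {n t j : ℕ} (ht : 1 ≤ t)
    (hj : j + t ≤ n) :
    ∏ i ∈ window n t j, MvPolynomial.X i ∈ pathIdeal K (pathGraph n) t := by
  obtain ⟨k, rfl⟩ := Nat.exists_eq_add_of_le' ht
  obtain ⟨v, p, hp⟩ := exists_walk_support_eq_range' k j (by omega : j + k < n)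
  have hnodup : p.support.Nodup := List.Nodup.of_map Fin.val (hp ▸ List.nodup_range')
  have hlen : p.support.length = k + 1 := by simpa using congrArg List.length hp
  refine Ideal.subset_span ⟨_, v, p, p.isPath_def.2 hnodup, hlen, ?_⟩
  rw [← List.prod_toFinset _ hnodup]
  refine Finset.prod_congr ?_ fun _ _ => rfl
  ext i
  have hmem : i ∈ p.support ↔ (i : ℕ) ∈ p.support.map Fin.val := by
    simp [Fin.val_inj]
  rw [mem_window, List.mem_toFinset, hmem, hp, List.mem_range'_1]

theorem ordConnected_support_pathGraph {n : ℕ} {u v : Fin n} (p : (pathGraph n).Walk u v) :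
    ∀ x ∈ p.support, ∀ y ∈ p.support, ∀ z, x ≤ z → z ≤ y → z ∈ p.support := by
  induction p with
  | nil =>
    intro x hx y hy z hxz hzy
    simp only [Walk.support_nil, List.mem_singleton] at hx hy ⊢
    subst hx hy
    exact le_antisymm hzy hxz
  | @cons u u' v hadj p ih =>
    have hu' : u' ∈ p.support := p.start_mem_support
    have hadj' := pathGraph_adj.1 hadj
    intro x hx y hy z hxz hzy
    rw [Walk.support_cons, List.mem_cons] at hx hy ⊢
    by_cases hzu : z = u
    · exact Or.inl hzu
    refine Or.inr ?_
    have hzu' : (z : ℕ) ≠ u := fun h => hzu (Fin.ext h)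
    rw [Fin.le_def] at hxz hzy
    rcases hx with rfl | hx <;> rcases hy with rfl | hy
    · omega
    · exact ih u' hu' y hy z (Fin.le_def.2 (by omega)) hzy
    · exact ih x hx u' hu' z hxz (Fin.le_def.2 (by omega))
    · exact ih x hx y hy z hxz hzy

/-- The support of a walk is order-convex, so one with `t` distinct vertices contains the window
starting at its minimum. -/
theorem exists_mem_support_of_isWindowCover {n t : ℕ} (ht : 1 ≤ t) {C : Finset (Fin n)}
    (hC : IsWindowCover n t C) {u v : Fin n} {p : (pathGraph n).Walk u v} (hp : p.IsPath)
    (hlen : p.support.length = t) : ∃ c ∈ C, c ∈ p.support := by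
  have hne : p.support.toFinset.Nonempty := ⟨u, by simp⟩
  set m := p.support.toFinset.min' hne
  set M := p.support.toFinset.max' hne
  have hm : m ∈ p.support := List.mem_toFinset.1 (Finset.min'_mem _ hne)
  have hM : M ∈ p.support := List.mem_toFinset.1 (Finset.max'_mem _ hne)
  have hcard : t ≤ (Finset.Icc m M).card := by
    rw [← hlen, ← List.toFinset_card_of_nodup hp.support_nodup]
    exact Finset.card_le_card fun i hi =>
      Finset.mem_Icc.2 ⟨Finset.min'_le _ i hi, Finset.le_max' _ i hi⟩
  rw [Fin.card_Icc] at hcard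
  obtain ⟨c, hc, hcw⟩ := hC m (by omega)
  have hcw' := mem_window.1 hcw
  exact ⟨c, hc, ordConnected_support_pathGraph p m hm M hM c (Fin.le_def.2 hcw'.1)
    (Fin.le_def.2 (by omega))⟩

theorem X_dvd_scaleVars_of_mem_pathIdeal {K : Type*} [CommRing K] {n t : ℕ} (ht : 1 ≤ t)
    {C : Finset (Fin n)} (hC : IsWindowCover n t C) {f : MvPolynomial (Fin n) K}
    (hf : f ∈ pathIdeal K (pathGraph n) t) : Polynomial.X ∣ scaleVars K C f := by
  suffices hle : pathIdeal K (pathGraph n) t ≤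
      (Ideal.span {Polynomial.X}).comap (scaleVars K C) from
    Ideal.mem_span_singleton.1 (hle hf)
  refine Ideal.span_le.2 ?_
  rintro _ ⟨u, v, p, hp, hlen, rfl⟩
  obtain ⟨c, hc, hcp⟩ := exists_mem_support_of_isWindowCover ht hC hp hlen
  have hdvd : (MvPolynomial.X c : MvPolynomial (Fin n) K) ∣
      (p.support.map fun w => (MvPolynomial.X w : MvPolynomial (Fin n) K)).prod :=
    List.dvd_prod (List.mem_map.2 ⟨c, hcp, rfl⟩)
  refine Ideal.mem_span_singleton.2 (Dvd.dvd.trans ?_ (map_dvd (scaleVars K C) hdvd))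
  rw [scaleVars_X_of_mem hc]
  exact dvd_mul_left _ _

theorem corollary2p4 (K : Type*) [Field K] (n t : ℕ) (ht : 1 ≤ t) (htn : t ≤ n) :
    IsNormalIdeal (pathIdeal K (SimpleGraph.pathGraph n) t) := by
  intro s _
  refine Set.Subset.antisymm (fun r hr => ?_) (subset_idealIntegralClosure _)
  -- Each cover gives one valuation, hence one inequality on the exponents of `r`.
  have hcov : ∀ d ∈ r.support, ∀ C, IsWindowCover n t C → s ≤ ∑ i ∈ C, d i := by
    intro d hd C hC
    have hJ : ∀ x ∈ pathIdeal K (pathGraph n) t ^ s,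
        Polynomial.X ^ s ∣ scaleVars K C x := fun x hx =>
      pow_dvd_map_of_mem_pow _ (fun y hy => X_dvd_scaleVars_of_mem_pathIdeal ht hC hy) s hx
    have hdvd := pow_dvd_of_mem_idealIntegralClosure (scaleVars K C) Polynomial.prime_X hJ hr
    by_contra! hlt
    refine MvPolynomial.mem_support_iff.1 hd ?_
    rw [← coeff_coeff_scaleVars C d r, Polynomial.X_pow_dvd_iff.1 hdvd _ hlt,
      MvPolynomial.coeff_zero]
  rw [SetLike.mem_coe, r.as_sum]
  refine Ideal.sum_mem _ fun d hd => ?_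
  rw [MvPolynomial.monomial_eq, Finsupp.prod_fintype _ _ (by simp)]
  exact Ideal.mul_mem_left _ _
    (prod_X_pow_mem_pow (fun j hj => prod_window_mem_pathIdeal K ht hj) s d (hcov d hd))
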